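/- Let $K$ be a compact Lie group (not necessarily connected) and let $H\subset K$ be a compact subgroup containing a maximal torus of $K$. Equip $K/H$ with its structure of a homogeneous smooth manifold, that is, the quotient topology and the unique smooth structure for which the projection $K\to K/H$ is a smooth submersion, and let $K$ act on $K/H$ by left translations. Let $\omega$ be a smooth real-valued $K$-invariant closed two-form on $K/H$. Then $\omega$ is exact, i.e. $\omega=d\eta$ for some smooth one-form $\eta$ on $K/H$, if and only if $\omega=0$. -/

import Mathlib

open scoped Manifold ContDiff Topology

/-! ### Tori in a topological group -/

section Tori

variable {K : Type*} [Group K] [TopologicalSpace K]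

/-- A torus in a Lie group `K`: a compact connected abelian subgroup. (A compact subgroup of a Lie
group is closed, hence a Lie subgroup; so these are the compact connected abelian Lie subgroups,
i.e. the subgroups isomorphic to some `(S¹)ⁿ`.) -/
structure IsTorus (T : Subgroup K) : Prop where
  isCompact : IsCompact (T : Set K)
  isConnected : IsConnected (T : Set K)
  mul_comm : ∀ a ∈ T, ∀ b ∈ T, a * b = b * a

/-- A maximal torus: a torus which is maximal with respect to inclusion among all tori of `K`. -/
def IsMaximalTorus (T : Subgroup K) : Prop :=
  Maximal IsTorus T

end Tori

/-! ### Differential forms on manifolds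

Manifolds are finite-dimensional real manifolds without boundary, modelled on a normed space `E`.
-/

noncomputable section Forms

variable {E : Type*} [NormedAddCommGroup E] [NormedSpace ℝ E]
  {M : Type*} [TopologicalSpace M] [ChartedSpace E M]
  {E' : Type*} [NormedAddCommGroup E'] [NormedSpace ℝ E']
  {N : Type*} [TopologicalSpace N] [ChartedSpace E' N]

variable (E M) in
/-- Real-valued differential forms of degree `k` on `M`, with no regularity imposed: a choice of an
alternating `k`-linear form on every tangent space. Smoothness is `DiffForm.IsSmooth` below. -/
abbrev DiffForm (k : ℕ) : Type _ :=
  (x : M) → (TangentSpace 𝓘(ℝ, E) x) [⋀^Fin k]→L[ℝ] ℝ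

/-- The pullback `f^* α`, `(f^* α)_x (v₁, …, v_k) = α_{f x} (df_x v₁, …, df_x v_k)`. -/
def DiffForm.pullback {k : ℕ} (f : M → N) (α : DiffForm E' N k) : DiffForm E M k :=
  fun x => (α (f x)).compContinuousLinearMap (mfderiv 𝓘(ℝ, E) 𝓘(ℝ, E') f x)

/-- The expression of `α` in the chart around `x₀`: the pullback of `α` under the inverse of this
chart, a differential form on the model space `E` (meaningful on the target of the chart). -/
def DiffForm.inChart {k : ℕ} (α : DiffForm E M k) (x₀ : M) : E → E [⋀^Fin k]→L[ℝ] ℝ :=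
  fun y => (α ((extChartAt 𝓘(ℝ, E) x₀).symm y)).compContinuousLinearMap
    (mfderiv 𝓘(ℝ, E) 𝓘(ℝ, E) (extChartAt 𝓘(ℝ, E) x₀).symm y)

/-- A differential form is smooth if its expressions in the charts of the atlas are `C^∞`. -/
def DiffForm.IsSmooth {k : ℕ} (α : DiffForm E M k) : Prop :=
  ∀ x₀ : M, ContDiffOn ℝ ∞ (α.inChart x₀) (extChartAt 𝓘(ℝ, E) x₀).target

/-- The exterior derivative `dα`: at the point `x`, differentiate the expression of `α` in the chart
`φ` around `x`, and pull the result back under `φ`. -/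
def DiffForm.d {k : ℕ} (α : DiffForm E M k) : DiffForm E M (k + 1) :=
  fun x => (extDeriv (α.inChart x) (extChartAt 𝓘(ℝ, E) x x)).compContinuousLinearMap
    (mfderiv 𝓘(ℝ, E) 𝓘(ℝ, E) (extChartAt 𝓘(ℝ, E) x) x)

/-- A form is closed if its exterior derivative vanishes. -/
def DiffForm.IsClosed {k : ℕ} (α : DiffForm E M k) : Prop :=
  α.d = 0

/-- A form is exact if it is the exterior derivative of a smooth form. -/
def DiffForm.IsExact {k : ℕ} (α : DiffForm E M (k + 1)) : Prop :=
  ∃ η : DiffForm E M k, η.IsSmooth ∧ η.d = α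

/-- A form on a manifold with an action of `K` is `K`-invariant if its pullback under the action map
`x ↦ g • x` of every `g : K` is the form itself. -/
def DiffForm.IsInvariant (K : Type*) [SMul K M] {k : ℕ} (α : DiffForm E M k) : Prop :=
  ∀ g : K, α.pullback (fun x : M => g • x) = α

end Forms

/-!
Let `ω = dη` be invariant, with `η` a smooth one-form on `K ⧸ H`. Since `ω = k^* ω = d(k^* η)` for
every `k : K`, the form `ω` is also the exterior derivative of the average of the translates
`k^* η` with respect to Haar measure. This average is a `K`-invariant one-form, and such a form
vanishes when `H` contains a maximal torus `T`. Indeed, lifted to `K` it is given by a functional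
`l` on the Lie algebra `𝔨` that is `Ad H`-invariant and vanishes on the Lie algebra of `H`. By
averaging over `T`, `l Z = l Z'` for some `Z'` fixed by `Ad T`; the one-parameter subgroup generated
by `Z'` commutes with `T`, so it lies in `T ≤ H` by maximality, and `l Z' = 0`.

The averaged form is not constructed as a differential form. Only its values, the integrals of
`(k^* η) (v)` over `k`, are considered. That they vanish is
`DiffForm.integral_liftAt_apply_eq_zero`, which rests on
`exists_isMIntegralCurve_mulInvariantVectorField` (one-parameter subgroups, as complete integral
curves of left-invariant vector fields), `IsMaximalTorus.mem_of_forall_commute` and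
`exists_Ad_eq_and_eq`. That `ω` then vanishes is
`DiffForm.d_eq_zero_of_integral_pullback_smul_eq_zero`, which combines `DiffForm.d_pullback`
with differentiation under the integral sign in a chart. Smoothness of the action of `K` on `K ⧸ H`
comes from local sections of the submersion `K → K ⧸ H`.

Many terms carry ascriptions that replace a tangent space by the model space: the two are
definitionally equal, and without the base point in the type one can rewrite along equalities of
points.
-/

noncomputable section InvariantForms

open Set Filter MeasureTheory

/-! ### Pullbacks and the exterior derivative -/

namespace DiffForm

variable {E : Type*} [NormedAddCommGroup E] [NormedSpace ℝ E]
  {M : Type*} [TopologicalSpace M] [ChartedSpace E M]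
  {E' : Type*} [NormedAddCommGroup E'] [NormedSpace ℝ E']
  {N : Type*} [TopologicalSpace N] [ChartedSpace E' N]
  {E'' : Type*} [NormedAddCommGroup E''] [NormedSpace ℝ E'']
  {P : Type*} [TopologicalSpace P] [ChartedSpace E'' P] {k : ℕ}

theorem pullback_comp_apply (α : DiffForm E'' P k) {g : N → P} {f : M → N} {x : M}
    (hg : MDifferentiableAt 𝓘(ℝ, E') 𝓘(ℝ, E'') g (f x))
    (hf : MDifferentiableAt 𝓘(ℝ, E) 𝓘(ℝ, E') f x) :
    α.pullback (E := E) (g ∘ f) x = (α.pullback (E := E') g).pullback (E := E) f x := by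
  unfold pullback
  rw [mfderiv_comp x hg hf]
  rfl

/-- The pullback at a point depends only on the germ of the map there. -/
theorem pullback_congr (α : DiffForm E' N k) {f g : M → N} {x : M} (h : f =ᶠ[𝓝 x] g) :
    α.pullback (E := E) f x = α.pullback (E := E) g x := by
  have h₁ : (α (f x) : E' [⋀^Fin k]→L[ℝ] ℝ) = α (g x) :=
    by
    rw [h.eq_of_nhds]
  have h₂ : (mfderiv 𝓘(ℝ, E) 𝓘(ℝ, E') f x : E →L[ℝ] E') = mfderiv 𝓘(ℝ, E) 𝓘(ℝ, E') g x :=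
    h.mfderiv_eq
  exact congrArg₂ (fun (a : E' [⋀^Fin k]→L[ℝ] ℝ) (b : E →L[ℝ] E') ↦
    a.compContinuousLinearMap b) h₁ h₂

/-- The chart expression is itself a pullback, to the model space seen as a manifold. -/
theorem inChart_eq_pullback (α : DiffForm E M k) (x₀ : M) :
    α.inChart x₀ = α.pullback (extChartAt 𝓘(ℝ, E) x₀).symm := rfl

theorem pullback_eq_fderiv (β : DiffForm E' E' k) (G : E → E') (y : E) :
    (β.pullback (E := E) G y : E [⋀^Fin k]→L[ℝ] ℝ) =
      (β (G y) : E' [⋀^Fin k]→L[ℝ] ℝ).compContinuousLinearMap (fderiv ℝ G y) :=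
  congrArg (fun b : E →L[ℝ] E' ↦ (β (G y) : E' [⋀^Fin k]→L[ℝ] ℝ).compContinuousLinearMap b)
    mfderiv_eq_fderiv

variable [IsManifold 𝓘(ℝ, E) ∞ M] [IsManifold 𝓘(ℝ, E') ∞ N]

/-- In charts around `x₀` and `z`, the pullback of a form under `f` is the pullback, in the sense of
normed spaces, under the coordinate expression of `f`. -/
theorem inChart_pullback_apply (α : DiffForm E' N k) {f : M → N} (x₀ : M) (z : N) {y : E}
    (hy : y ∈ (extChartAt 𝓘(ℝ, E) x₀).target)
    (hf : ContMDiffAt 𝓘(ℝ, E) 𝓘(ℝ, E') ∞ f ((extChartAt 𝓘(ℝ, E) x₀).symm y))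
    (hz : f ((extChartAt 𝓘(ℝ, E) x₀).symm y) ∈ (extChartAt 𝓘(ℝ, E') z).source) :
    (α.pullback (E := E) f).inChart x₀ y =
      (α.inChart z (extChartAt 𝓘(ℝ, E') z
        (f ((extChartAt 𝓘(ℝ, E) x₀).symm y)))).compContinuousLinearMap
        (fderiv ℝ (fun y ↦ extChartAt 𝓘(ℝ, E') z (f ((extChartAt 𝓘(ℝ, E) x₀).symm y))) y) := by
  set φ := extChartAt 𝓘(ℝ, E) x₀ with hφ
  set ψ := extChartAt 𝓘(ℝ, E') z with hψ
  set G : E → E' := fun y ↦ ψ (f (φ.symm y)) with hG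
  have h1 : ContMDiffAt 𝓘(ℝ, E) 𝓘(ℝ, E) ∞ φ.symm y :=
    (contMDiffOn_extChartAt_symm x₀).contMDiffAt ((isOpen_extChartAt_target x₀).mem_nhds hy)
  have h2 : ContMDiffAt 𝓘(ℝ, E) 𝓘(ℝ, E') ∞ (f ∘ φ.symm) y := hf.comp y h1
  have h3 : ContMDiffAt 𝓘(ℝ, E') 𝓘(ℝ, E') ∞ ψ (f (φ.symm y)) :=
    contMDiffAt_extChartAt' (by simpa [hψ] using hz)
  have h4 : ContMDiffAt 𝓘(ℝ, E) 𝓘(ℝ, E') ∞ G y := h3.comp y h2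
  have h5 : ContMDiffAt 𝓘(ℝ, E') 𝓘(ℝ, E') ∞ ψ.symm (G y) :=
    (contMDiffOn_extChartAt_symm z).contMDiffAt
      ((isOpen_extChartAt_target z).mem_nhds (ψ.map_source hz))
  have h6 : f ∘ φ.symm =ᶠ[𝓝 y] ψ.symm ∘ G := by
    filter_upwards [h2.continuousAt.preimage_mem_nhds
      ((isOpen_extChartAt_source z).mem_nhds hz)] with w hw
    exact (ψ.left_inv hw).symm
  have hi : (∞ : WithTop ℕ∞) ≠ 0 := by simp
  rw [inChart_eq_pullback, ← pullback_comp_apply α (hf.mdifferentiableAt hi)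
    (h1.mdifferentiableAt hi), pullback_congr α h6, pullback_comp_apply α
    (h5.mdifferentiableAt hi) (h4.mdifferentiableAt hi)]
  exact pullback_eq_fderiv (α.inChart z) G y

/-- A form is recovered at `x` from its expression in the chart around `x`. -/
theorem eq_compContinuousLinearMap_inChart (α : DiffForm E M k) (x : M) :
    (α x : E [⋀^Fin k]→L[ℝ] ℝ) =
      (α.inChart x (extChartAt 𝓘(ℝ, E) x x)).compContinuousLinearMap
        (mfderiv 𝓘(ℝ, E) 𝓘(ℝ, E) (extChartAt 𝓘(ℝ, E) x) x : E →L[ℝ] E) := by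
  set φ := extChartAt 𝓘(ℝ, E) x with hφ
  have hi : (∞ : WithTop ℕ∞) ≠ 0 := by simp
  have h1 : ContMDiffAt 𝓘(ℝ, E) 𝓘(ℝ, E) ∞ φ.symm (φ x) :=
    (contMDiffOn_extChartAt_symm x).contMDiffAt
      ((isOpen_extChartAt_target x).mem_nhds (mem_extChartAt_target x))
  have h2 : ContMDiffAt 𝓘(ℝ, E) 𝓘(ℝ, E) ∞ φ x := contMDiffAt_extChartAt
  have h3 : φ.symm ∘ φ =ᶠ[𝓝 x] id := by
    filter_upwards [(isOpen_extChartAt_source (I := 𝓘(ℝ, E)) x).mem_nhds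
      (mem_extChartAt_source x)] with w hw using φ.left_inv hw
  have h4 : α.pullback (E := E) id x = α x := by
    unfold pullback
    rw [mfderiv_id]
    rfl
  rw [← h4, ← pullback_congr α h3, pullback_comp_apply α (h1.mdifferentiableAt hi)
    (h2.mdifferentiableAt hi)]
  rfl

/-- The exterior derivative commutes with the pullback under a smooth map. -/
theorem d_pullback {α : DiffForm E' N k} (hα : α.IsSmooth) {f : M → N}
    (hf : ContMDiff 𝓘(ℝ, E) 𝓘(ℝ, E') ∞ f) : (α.pullback (E := E) f).d = α.d.pullback f := by
  funext x
  have hi : (∞ : WithTop ℕ∞) ≠ 0 := by simp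
  set φ := extChartAt 𝓘(ℝ, E) x with hφ
  set ψ := extChartAt 𝓘(ℝ, E') (f x) with hψ
  set G : E → E' := fun y ↦ ψ (f (φ.symm y)) with hG
  have hxs : x ∈ φ.source := mem_extChartAt_source x
  have hφx : φ.symm (φ x) = x := φ.left_inv hxs
  have hGx : G (φ x) = ψ (f x) := by simp only [hG, hφx]
  have h1 : ContMDiffAt 𝓘(ℝ, E) 𝓘(ℝ, E) ∞ φ.symm (φ x) :=
    (contMDiffOn_extChartAt_symm x).contMDiffAt
      ((isOpen_extChartAt_target x).mem_nhds (mem_extChartAt_target x))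
  have h3 : ContMDiffAt 𝓘(ℝ, E') 𝓘(ℝ, E') ∞ ψ (f x) := contMDiffAt_extChartAt
  have h4 : ContMDiffAt 𝓘(ℝ, E) 𝓘(ℝ, E') ∞ G (φ x) := by
    refine ContMDiffAt.comp (φ x) (g := ψ) ?_ (hf.contMDiffAt.comp (φ x) h1)
    simpa only [Function.comp_apply, hφx] using h3
  have h5 : ContMDiffAt 𝓘(ℝ, E) 𝓘(ℝ, E) ∞ φ x := contMDiffAt_extChartAt
  have hev : (α.pullback (E := E) f).inChart x =ᶠ[𝓝 (φ x)] fun y ↦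
      (α.inChart (f x) (G y)).compContinuousLinearMap (fderiv ℝ G y) := by
    filter_upwards [(isOpen_extChartAt_target x).mem_nhds (mem_extChartAt_target x),
      (hf.contMDiffAt.comp (φ x) h1).continuousAt.preimage_mem_nhds
      ((isOpen_extChartAt_source (I := 𝓘(ℝ, E')) (f x)).mem_nhds
        (by simpa only [Function.comp_apply, hφx] using mem_extChartAt_source (f x)))] with y hy hy'
    exact inChart_pullback_apply α x (f x) hy hf.contMDiffAt hy'
  have hd : DifferentiableAt ℝ (α.inChart (f x)) (G (φ x)) := by
    rw [hGx]
    exact ((hα (f x)).contDiffAt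
      ((isOpen_extChartAt_target _).mem_nhds (mem_extChartAt_target _))).differentiableAt hi
  -- Both sides are pullbacks to `T_x M` of this form on the model space: along `G ∘ φ` and `ψ ∘ f`.
  let β : DiffForm E' E' (k + 1) := extDeriv (α.inChart (f x))
  have key : extDeriv ((α.pullback (E := E) f).inChart x) (φ x) =
      β.pullback (E := E) G (φ x) := by
    rw [hev.extDeriv_eq, extDeriv_pullback hd h4.contDiffAt (by simpa using ENat.LEInfty.out)]
    exact (pullback_eq_fderiv β G (φ x)).symm
  have hGφ : G ∘ φ =ᶠ[𝓝 x] ψ ∘ f := by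
    filter_upwards [(isOpen_extChartAt_source (I := 𝓘(ℝ, E)) x).mem_nhds hxs] with w hw
    simp only [Function.comp_apply, hG]
    rw [φ.left_inv hw]
  have l : (α.pullback (E := E) f).d x =
      (β.pullback (E := E) G).pullback (E := E) φ x :=
    congrArg (fun a : E [⋀^Fin (k + 1)]→L[ℝ] ℝ ↦ a.compContinuousLinearMap
      (mfderiv 𝓘(ℝ, E) 𝓘(ℝ, E) φ x : E →L[ℝ] E)) key
  rw [l, ← pullback_comp_apply _ (h4.mdifferentiableAt hi) (h5.mdifferentiableAt hi),
    pullback_congr _ hGφ, pullback_comp_apply _ (h3.mdifferentiableAt hi)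
      (hf.contMDiffAt.mdifferentiableAt hi)]
  rfl

theorem isExact_zero {E : Type*} [NormedAddCommGroup E] [NormedSpace ℝ E]
    {M : Type*} [TopologicalSpace M] [ChartedSpace E M] {k : ℕ} :
    (0 : DiffForm E M (k + 1)).IsExact := by
  have h0 : ∀ x₀ : M, DiffForm.inChart (0 : DiffForm E M k) x₀ = 0 := fun x₀ ↦ by
    funext y; ext v; rfl
  refine ⟨0, fun x₀ ↦ ?_, ?_⟩
  · rw [h0]
    exact contDiffOn_const
  · funext x
    have h1 : extDeriv (DiffForm.inChart (0 : DiffForm E M k) x)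
        (extChartAt 𝓘(ℝ, E) x x) = 0 := by
      rw [h0]
      ext v
      rw [extDeriv_apply (by fun_prop)]
      simp
    ext v
    exact congrArg (fun a : E [⋀^Fin (k + 1)]→L[ℝ] ℝ ↦ a.compContinuousLinearMap
      (mfderiv 𝓘(ℝ, E) 𝓘(ℝ, E) (extChartAt 𝓘(ℝ, E) x) x : E →L[ℝ] E) v) h1

end DiffForm

/-! ### Integrals depending on a parameter in a manifold -/

section Calculus

/-- Differentiation under the integral sign over a compact space: joint continuity of the partial
derivative provides the uniform bound needed for dominated convergence. -/
theorem hasFDerivAt_integral_of_continuousAt_fderiv {X V W : Type*} [TopologicalSpace X]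
    [CompactSpace X] [SecondCountableTopology X] [MeasurableSpace X] [OpensMeasurableSpace X]
    {μ : Measure X} [IsFiniteMeasure μ]
    [NormedAddCommGroup V] [NormedSpace ℝ V] [FiniteDimensional ℝ V]
    [NormedAddCommGroup W] [NormedSpace ℝ W] {F : X → V → W} {U : Set V} (hU : IsOpen U)
    (hF : ∀ p : X × V, p.2 ∈ U → ContinuousAt (Function.uncurry F) p)
    (hd : ∀ x, ∀ y ∈ U, DifferentiableAt ℝ (F x) y)
    (hF' : ∀ p : X × V, p.2 ∈ U → ContinuousAt (fun p : X × V ↦ fderiv ℝ (F p.1) p.2) p)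
    {y₀ : V} (hy₀ : y₀ ∈ U) :
    HasFDerivAt (fun y ↦ ∫ x, F x y ∂μ) (∫ x, fderiv ℝ (F x) y₀ ∂μ) y₀ := by
  have : ProperSpace V := FiniteDimensional.proper ℝ V
  have hcF : ∀ y ∈ U, Continuous (fun x ↦ F x y) := fun y hy ↦
    continuous_iff_continuousAt.2 fun x ↦
      ContinuousAt.comp (f := fun x : X ↦ (x, y)) (hF (x, y) hy) (by fun_prop)
  have hcF' : ∀ y ∈ U, Continuous (fun x ↦ fderiv ℝ (F x) y) := fun y hy ↦
    continuous_iff_continuousAt.2 fun x ↦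
      ContinuousAt.comp (f := fun x : X ↦ (x, y)) (hF' (x, y) hy) (by fun_prop)
  obtain ⟨s, hs, hsU, hsc⟩ := local_compact_nhds (hU.mem_nhds hy₀)
  have hbdd : BddAbove ((fun p : X × V ↦ ‖fderiv ℝ (F p.1) p.2‖) '' (univ ×ˢ s)) := by
    refine (isCompact_univ.prod hsc).bddAbove_image fun p hp ↦ ?_
    exact (hF' p (hsU hp.2)).norm.continuousWithinAt
  obtain ⟨C, hC⟩ := hbdd
  refine hasFDerivAt_integral_of_dominated_of_fderiv_le (F := fun y x ↦ F x y)
    (F' := fun y x ↦ fderiv ℝ (F x) y) (bound := fun _ ↦ C) hs ?_ ?_ ?_ ?_ ?_ ?_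
  · filter_upwards [hs] with y hy using (hcF y (hsU hy)).aestronglyMeasurable
  · exact (hcF y₀ hy₀).integrable_of_hasCompactSupport (HasCompactSupport.of_compactSpace _)
  · exact (hcF' y₀ hy₀).aestronglyMeasurable
  · exact Eventually.of_forall fun x y hy ↦ hC ⟨(x, y), ⟨mem_univ _, hy⟩, rfl⟩
  · exact integrable_const C
  · exact Eventually.of_forall fun x y hy ↦ (hd x y (hsU hy)).hasFDerivAt

/-- Let `F x` be a family of functions whose integral over the compact parameter space vanishes
near `y₀`. If a linear expression `Λ` in the derivative at `y₀` does not depend on the parameter,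
then it is zero, being up to a nonzero factor its own integral. -/
theorem eq_zero_of_integral_eq_zero_of_map_fderiv_eq {X V W Z : Type*} [TopologicalSpace X]
    [CompactSpace X] [SecondCountableTopology X] [MeasurableSpace X] [OpensMeasurableSpace X]
    {μ : Measure X} [IsFiniteMeasure μ] [NeZero μ]
    [NormedAddCommGroup V] [NormedSpace ℝ V] [FiniteDimensional ℝ V]
    [NormedAddCommGroup W] [NormedSpace ℝ W] [CompleteSpace W]
    [NormedAddCommGroup Z] [NormedSpace ℝ Z] [CompleteSpace Z]
    {F : X → V → W} {U : Set V} (hU : IsOpen U)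
    (hF : ∀ p : X × V, p.2 ∈ U → ContinuousAt (Function.uncurry F) p)
    (hd : ∀ x, ∀ y ∈ U, DifferentiableAt ℝ (F x) y)
    (hF' : ∀ p : X × V, p.2 ∈ U → ContinuousAt (fun p : X × V ↦ fderiv ℝ (F p.1) p.2) p)
    (hzero : ∀ y ∈ U, ∫ x, F x y ∂μ = 0) {y₀ : V} (hy₀ : y₀ ∈ U)
    (Λ : (V →L[ℝ] W) →L[ℝ] Z) {c : Z} (hc : ∀ x, Λ (fderiv ℝ (F x) y₀) = c) : c = 0 := by
  have hint := hasFDerivAt_integral_of_continuousAt_fderiv (μ := μ) hU hF hd hF' hy₀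
  have hfd : ∫ x, fderiv ℝ (F x) y₀ ∂μ = 0 := by
    rw [← hint.fderiv]
    have : (fun y ↦ ∫ x, F x y ∂μ) =ᶠ[𝓝 y₀] fun _ ↦ 0 := by
      filter_upwards [hU.mem_nhds hy₀] with y hy using hzero y hy
    rw [this.fderiv_eq, fderiv_const_apply]
  have hcd : Continuous fun x ↦ fderiv ℝ (F x) y₀ := continuous_iff_continuousAt.2 fun x ↦
    ContinuousAt.comp (f := fun x : X ↦ (x, y₀)) (hF' (x, y₀) hy₀) (by fun_prop)
  have hfin := Λ.integral_comp_comm (μ := μ)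
    (hcd.integrable_of_hasCompactSupport (HasCompactSupport.of_compactSpace _))
  simp only [hc, hfd, map_zero, integral_const] at hfin
  exact (smul_eq_zero.1 hfin).resolve_left 
    (ENNReal.toReal_ne_zero.2 ⟨by simp [NeZero.ne μ], measure_ne_top _ _⟩)

/-- The partial derivative of a smooth function of a parameter in a manifold and a vector is jointly
smooth. -/
theorem ContMDiffAt.fderiv_right_of_uncurry {B : Type*} [NormedAddCommGroup B] [NormedSpace ℝ B]
    {X : Type*} [TopologicalSpace X] [ChartedSpace B X] [IsManifold 𝓘(ℝ, B) ∞ X]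
    {V W : Type*} [NormedAddCommGroup V] [NormedSpace ℝ V]
    [NormedAddCommGroup W] [NormedSpace ℝ W] {F : X → V → W} {p : X × V}
    (hF : ContMDiffAt (𝓘(ℝ, B).prod 𝓘(ℝ, V)) 𝓘(ℝ, W) ∞ (Function.uncurry F) p) :
    ContMDiffAt (𝓘(ℝ, B).prod 𝓘(ℝ, V)) 𝓘(ℝ, V →L[ℝ] W) ∞
      (fun p : X × V ↦ fderiv ℝ (F p.1) p.2) p := by
  have h : ContMDiffAt ((𝓘(ℝ, B).prod 𝓘(ℝ, V)).prod 𝓘(ℝ, V)) 𝓘(ℝ, W) ∞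
      (Function.uncurry fun (q : X × V) (y : V) ↦ F q.1 y) (p, p.2) :=
    ContMDiffAt.comp (p, p.2) (g := Function.uncurry F) (f := fun q : (X × V) × V ↦ (q.1.1, q.2))
      hF ((contMDiff_fst.comp contMDiff_fst).prodMk contMDiff_snd).contMDiffAt
  have : IsManifold 𝓘(ℝ, B) 1 X := .of_le (n := ∞) (by simp)
  have := h.mfderiv (m := ∞) (fun (q : X × V) (y : V) ↦ F q.1 y) Prod.snd contMDiffAt_snd (by simp)
  have e := inTangentCoordinates_model_space (I := 𝓘(ℝ, V)) (I' := 𝓘(ℝ, W))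
    (Prod.snd : X × V → V) (fun q ↦ F q.1 q.2) (fun q ↦ fderiv ℝ (F q.1) q.2) p
  simp only [mfderiv_eq_fderiv] at this
  rw [← e]
  exact this

end Calculus

/-! ### Averaging a one-form over a group -/

namespace DiffForm

variable {E : Type*} [NormedAddCommGroup E] [NormedSpace ℝ E]
  {K : Type*} [TopologicalSpace K] [ChartedSpace E K] [IsManifold 𝓘(ℝ, E) ∞ K]
  {E' : Type*} [NormedAddCommGroup E'] [NormedSpace ℝ E']
  {M : Type*} [TopologicalSpace M] [ChartedSpace E' M] [IsManifold 𝓘(ℝ, E') ∞ M]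
  [SMul K M]

/-- For a smooth action, the chart expression of the translates `k^* η` of a smooth `1`-form is
jointly smooth in the group element and the point. -/
theorem contMDiffAt_inChart_pullback_smul [ContMDiffSMul 𝓘(ℝ, E) 𝓘(ℝ, E') ∞ K M]
    {η : DiffForm E' M 1} (hη : η.IsSmooth) (x₀ : M)
    {p : K × E'} (hp : p.2 ∈ (extChartAt 𝓘(ℝ, E') x₀).target) :
    ContMDiffAt (𝓘(ℝ, E).prod 𝓘(ℝ, E')) 𝓘(ℝ, E' [⋀^Fin 1]→L[ℝ] ℝ) ∞
      (fun p : K × E' ↦ (η.pullback (E := E') (fun x : M ↦ p.1 • x)).inChart x₀ p.2) p := by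
  set φ := extChartAt 𝓘(ℝ, E') x₀ with hφ
  set z : M := p.1 • φ.symm p.2 with hz
  set ψ := extChartAt 𝓘(ℝ, E') z with hψ
  have hact : ContMDiffAt (𝓘(ℝ, E).prod 𝓘(ℝ, E')) 𝓘(ℝ, E') ∞
      (fun p : K × E' ↦ p.1 • φ.symm p.2) p := by
    refine ContMDiffAt.smul (I := 𝓘(ℝ, E)) (I' := 𝓘(ℝ, E')) contMDiffAt_fst ?_
    exact ContMDiffAt.comp p ((contMDiffOn_extChartAt_symm x₀).contMDiffAt
      ((isOpen_extChartAt_target x₀).mem_nhds hp)) contMDiffAt_snd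
  set G : K → E' → E' := fun k y ↦ ψ (k • φ.symm y) with hG
  have hGs : ContMDiffAt (𝓘(ℝ, E).prod 𝓘(ℝ, E')) 𝓘(ℝ, E') ∞ (Function.uncurry G) p :=
    ContMDiffAt.comp p (g := ψ) contMDiffAt_extChartAt hact
  have hG' := hGs.fderiv_right_of_uncurry
  have hη' : ContMDiffAt (𝓘(ℝ, E).prod 𝓘(ℝ, E')) 𝓘(ℝ, E' [⋀^Fin 1]→L[ℝ] ℝ) ∞
      (fun q : K × E' ↦ η.inChart z (G q.1 q.2)) p := by
    refine ContMDiffAt.comp p (g := η.inChart z) (f := Function.uncurry G) ?_ hGs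
    exact ((hη z).contDiffAt ((isOpen_extChartAt_target _).mem_nhds
      (mem_extChartAt_target z))).contMDiffAt
  -- Identifying `1`-forms with functionals turns the pullback into composition of linear maps.
  let L := ContinuousAlternatingMap.ofSubsingletonLIE (𝕜 := ℝ) (E := E') (F := ℝ) (0 : Fin 1)
  have hcomp : ContMDiffAt (𝓘(ℝ, E).prod 𝓘(ℝ, E')) 𝓘(ℝ, E' [⋀^Fin 1]→L[ℝ] ℝ) ∞
      (fun q : K × E' ↦ L ((L.symm (η.inChart z (G q.1 q.2))).comp (fderiv ℝ (G q.1) q.2))) p := by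
    refine L.toContinuousLinearEquiv.contDiff.contMDiff.contMDiffAt.comp p ?_
    refine ContMDiffAt.clm_comp ?_ hG'
    exact L.symm.toContinuousLinearEquiv.contDiff.contMDiff.contMDiffAt.comp p hη'
  refine hcomp.congr_of_eventuallyEq ?_
  filter_upwards [hact.continuousAt.preimage_mem_nhds ((isOpen_extChartAt_source z).mem_nhds
    (mem_extChartAt_source (I := 𝓘(ℝ, E')) z)), continuousAt_snd.preimage_mem_nhds
    ((isOpen_extChartAt_target x₀).mem_nhds hp)] with q hq hq'
  rw [inChart_pullback_apply η x₀ z hq'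
    (ContMDiffSMul.contMDiff_const_smul (I := 𝓘(ℝ, E)) q.1).contMDiffAt hq]
  ext v
  obtain ⟨w, rfl⟩ : ∃ w, v = fun _ ↦ w := ⟨v 0, funext fun i ↦ by rw [Subsingleton.elim i 0]⟩
  rfl

variable (E) in
theorem continuous_pullback_smul [ContMDiffSMul 𝓘(ℝ, E) 𝓘(ℝ, E') ∞ K M]
    {η : DiffForm E' M 1} (hη : η.IsSmooth) (x : M) :
    Continuous fun k : K ↦
      (η.pullback (E := E') (fun x : M ↦ k • x) x : E' [⋀^Fin 1]→L[ℝ] ℝ) := by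
  have h : Continuous fun k : K ↦ (η.pullback (E := E') (fun x : M ↦ k • x)).inChart x
      (extChartAt 𝓘(ℝ, E') x x) := continuous_iff_continuousAt.2 fun k ↦
    ContinuousAt.comp (x := k) (f := fun k : K ↦ (k, extChartAt 𝓘(ℝ, E') x x))
      (contMDiffAt_inChart_pullback_smul (E := E) hη x
        (p := (k, extChartAt 𝓘(ℝ, E') x x)) (mem_extChartAt_target x)).continuousAt (by fun_prop)
  simp_rw [eq_compContinuousLinearMap_inChart _ x]
  exact (ContinuousAlternatingMap.compContinuousLinearMapCLM (𝕜 := ℝ) (ι := Fin 1) (F := ℝ)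
    (mfderiv 𝓘(ℝ, E') 𝓘(ℝ, E') (extChartAt 𝓘(ℝ, E') x) x : E' →L[ℝ] E')).continuous.comp h

variable (E) in
/-- If the average of the translates `k^* η` of a smooth `1`-form vanishes and `dη` is invariant,
then `dη = 0`: each `d(k^* η) = k^* dη` is equal to `dη`, and the exterior derivative can be taken
under the integral. -/
theorem d_eq_zero_of_integral_pullback_smul_eq_zero
    [ContMDiffSMul 𝓘(ℝ, E) 𝓘(ℝ, E') ∞ K M] [FiniteDimensional ℝ E'] [CompactSpace K]
    [SecondCountableTopology K] [MeasurableSpace K] [OpensMeasurableSpace K]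
    (μ : Measure K) [IsFiniteMeasure μ] [NeZero μ] {η : DiffForm E' M 1} (hη : η.IsSmooth)
    (h₀ : ∀ (x : M) (v : E'),
      ∫ k : K, (η.pullback (E := E') (fun x : M ↦ k • x) x : E' [⋀^Fin 1]→L[ℝ] ℝ)
        (fun _ ↦ v) ∂μ = 0)
    (hinv : η.d.IsInvariant K) : η.d = 0 := by
  funext x
  set φ := extChartAt 𝓘(ℝ, E') x with hφ
  let F : K → E' → E' [⋀^Fin 1]→L[ℝ] ℝ :=
    fun k ↦ (η.pullback (E := E') (fun x : M ↦ k • x)).inChart x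
  have hF : ∀ p : K × E', p.2 ∈ φ.target →
      ContMDiffAt (𝓘(ℝ, E).prod 𝓘(ℝ, E')) 𝓘(ℝ, E' [⋀^Fin 1]→L[ℝ] ℝ) ∞
        (Function.uncurry F) p :=
    fun p hp ↦ contMDiffAt_inChart_pullback_smul hη x hp
  have hd : ∀ k, ∀ y ∈ φ.target, DifferentiableAt ℝ (F k) y := fun k y hy ↦
    (ContMDiffAt.comp y (f := fun y : E' ↦ (k, y)) (hF (k, y) hy)
      (contMDiffAt_const.prodMk contMDiffAt_id)).contDiffAt.differentiableAt (by simp)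
  have hx : φ x ∈ φ.target := mem_extChartAt_target x
  have hcont : ∀ y ∈ φ.target, Continuous fun k ↦ F k y := fun y hy ↦
    continuous_iff_continuousAt.2 fun k ↦
      ContinuousAt.comp (f := fun k : K ↦ (k, y)) (hF (k, y) hy).continuousAt (by fun_prop)
  have hzero : ∀ y ∈ φ.target, ∫ k, F k y ∂μ = 0 := by
    intro y hy
    ext v
    obtain ⟨w, rfl⟩ : ∃ w, v = fun _ ↦ w :=
      ⟨v 0, funext fun i ↦ by rw [Subsingleton.elim i 0]⟩
    exact ((ContinuousAlternatingMap.apply ℝ E' ℝ fun _ : Fin 1 ↦ w).integral_comp_comm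
      ((hcont y hy).integrable_of_hasCompactSupport
        (HasCompactSupport.of_compactSpace _))).symm.trans
      (h₀ (φ.symm y) (mfderiv 𝓘(ℝ, E') 𝓘(ℝ, E') φ.symm y w))
  have hdk : ∀ k : K, (η.d x : E' [⋀^Fin 2]→L[ℝ] ℝ) =
      (extDeriv (F k) (φ x)).compContinuousLinearMap
        (mfderiv 𝓘(ℝ, E') 𝓘(ℝ, E') φ x : E' →L[ℝ] E') := by
    intro k
    conv_lhs => rw [← hinv k, ← d_pullback hη
      (ContMDiffSMul.contMDiff_const_smul (I := 𝓘(ℝ, E)) k)]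
    rfl
  let Λ : (E' →L[ℝ] E' [⋀^Fin 1]→L[ℝ] ℝ) →L[ℝ] E' [⋀^Fin 2]→L[ℝ] ℝ :=
    (ContinuousAlternatingMap.compContinuousLinearMapCLM (𝕜 := ℝ) (ι := Fin 2) (F := ℝ)
      (mfderiv 𝓘(ℝ, E') 𝓘(ℝ, E') φ x : E' →L[ℝ] E')).comp
      (ContinuousAlternatingMap.alternatizeUncurryFinCLM ℝ E' ℝ)
  have hΛ : ∀ k : K, Λ (fderiv ℝ (F k) (φ x)) = (η.d x : E' [⋀^Fin 2]→L[ℝ] ℝ) :=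
    fun k ↦ (hdk k).symm
  exact eq_zero_of_integral_eq_zero_of_map_fderiv_eq (μ := μ) (isOpen_extChartAt_target x)
    (fun p hp ↦ (hF p hp).continuousAt) hd
    (fun p hp ↦ (hF p hp).fderiv_right_of_uncurry.continuousAt) hzero hx Λ hΛ

end DiffForm

/-! ### One-parameter subgroups and the adjoint action -/

section LieGroup

variable {E : Type*} [NormedAddCommGroup E] [NormedSpace ℝ E]
  {K : Type*} [Group K] [TopologicalSpace K] [ChartedSpace E K] [LieGroup 𝓘(ℝ, E) ∞ K]

variable (E) in
/-- The adjoint action of `t` on the Lie algebra `T₁K`: the derivative at `1` of conjugation by `t`.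
It is typed as an endomorphism of the model space `E`, to which `TangentSpace 𝓘(ℝ, E) (1 : K)` is
definitionally equal, because conjugation fixes `1` only propositionally. -/
def Ad (t : K) : E →L[ℝ] E :=
  (mfderiv 𝓘(ℝ, E) 𝓘(ℝ, E) (fun g : K ↦ t * g * t⁻¹) 1 : E →L[ℝ] E)

theorem contMDiff_conj (t : K) :
    ContMDiff 𝓘(ℝ, E) 𝓘(ℝ, E) ∞ (fun g : K ↦ t * g * t⁻¹) :=
  contMDiff_mul_right.comp contMDiff_mul_left

theorem mfderiv_mul_left_mulInvariantVectorField (k g : K) (Z : GroupLieAlgebra 𝓘(ℝ, E) K) :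
    mfderiv 𝓘(ℝ, E) 𝓘(ℝ, E) (fun x : K ↦ k * x) g (mulInvariantVectorField Z g) =
      mulInvariantVectorField Z (k * g) := by
  have hi : (∞ : WithTop ℕ∞) ≠ 0 := by simp
  have h1 : MDifferentiableAt 𝓘(ℝ, E) 𝓘(ℝ, E) (fun x : K ↦ k * x) (g * 1) :=
    (contMDiff_mul_left (n := ∞)).mdifferentiable hi _
  have h2 : MDifferentiableAt 𝓘(ℝ, E) 𝓘(ℝ, E) (fun x : K ↦ g * x) 1 :=
    (contMDiff_mul_left (n := ∞)).mdifferentiable hi _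
  have h := mfderiv_comp (1 : K) h1 h2
  have h3 : (fun x : K ↦ k * x) ∘ (fun x : K ↦ g * x) = fun x ↦ k * g * x := by
    funext x; simp [mul_assoc]
  rw [h3] at h
  have e : (mfderiv 𝓘(ℝ, E) 𝓘(ℝ, E) (fun x : K ↦ k * x) (g * 1) : E →L[ℝ] E) =
      mfderiv 𝓘(ℝ, E) 𝓘(ℝ, E) (fun x : K ↦ k * x) g := by rw [mul_one]
  have h' := congrArg (fun L : E →L[ℝ] E ↦ L Z) h
  refine Eq.trans ?_ h'.symm
  exact congrArg (fun L : E →L[ℝ] E ↦ L (mulInvariantVectorField Z g)) e.symm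

/-- Conjugation by `t` carries the left-invariant field of `Z` to that of `Ad t Z`. -/
theorem mfderiv_conj_mulInvariantVectorField (t g : K) (Z : GroupLieAlgebra 𝓘(ℝ, E) K) :
    (mfderiv 𝓘(ℝ, E) 𝓘(ℝ, E) (fun x : K ↦ t * x * t⁻¹) g (mulInvariantVectorField Z g) : E) =
      mulInvariantVectorField (I := 𝓘(ℝ, E)) (Ad E t Z) (t * g * t⁻¹) := by
  have hi : (∞ : WithTop ℕ∞) ≠ 0 := by simp
  have h1 : MDifferentiableAt 𝓘(ℝ, E) 𝓘(ℝ, E) (fun x : K ↦ t * x * t⁻¹) (g * 1) :=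
    (contMDiff_conj t).mdifferentiable hi _
  have h2 : MDifferentiableAt 𝓘(ℝ, E) 𝓘(ℝ, E) (fun x : K ↦ g * x) 1 :=
    (contMDiff_mul_left (n := ∞)).mdifferentiable hi _
  have h3 : MDifferentiableAt 𝓘(ℝ, E) 𝓘(ℝ, E) (fun x : K ↦ t * g * t⁻¹ * x) (t * 1 * t⁻¹) :=
    (contMDiff_mul_left (n := ∞)).mdifferentiable hi _
  have h4 : MDifferentiableAt 𝓘(ℝ, E) 𝓘(ℝ, E) (fun x : K ↦ t * x * t⁻¹) 1 :=
    (contMDiff_conj t).mdifferentiable hi _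
  have h := mfderiv_comp (1 : K) h1 h2
  have h' := mfderiv_comp (1 : K) h3 h4
  have e : (fun x : K ↦ t * x * t⁻¹) ∘ (fun x : K ↦ g * x) =
      (fun x : K ↦ t * g * t⁻¹ * x) ∘ (fun x : K ↦ t * x * t⁻¹) := by
    funext x; simp [mul_assoc]
  have e1 : (mfderiv 𝓘(ℝ, E) 𝓘(ℝ, E) (fun x : K ↦ t * x * t⁻¹) (g * 1) : E →L[ℝ] E) =
      mfderiv 𝓘(ℝ, E) 𝓘(ℝ, E) (fun x : K ↦ t * x * t⁻¹) g := by rw [mul_one]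
  have e2 : (mfderiv 𝓘(ℝ, E) 𝓘(ℝ, E) (fun x : K ↦ t * g * t⁻¹ * x) (t * 1 * t⁻¹) : E →L[ℝ] E) =
      mfderiv 𝓘(ℝ, E) 𝓘(ℝ, E) (fun x : K ↦ t * g * t⁻¹ * x) 1 := by
    rw [mul_one, mul_inv_cancel]
  have e3 := congrArg (fun f : K → K ↦ (mfderiv 𝓘(ℝ, E) 𝓘(ℝ, E) f 1 : E →L[ℝ] E) Z) e
  have h5 := congrArg (fun L : E →L[ℝ] E ↦ L Z) h
  have h6 := congrArg (fun L : E →L[ℝ] E ↦ L Z) h'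
  have h7 := h5.symm.trans (e3.trans h6)
  refine (congrArg (fun L : E →L[ℝ] E ↦ L (mulInvariantVectorField Z g)) e1.symm).trans
    (h7.trans ?_)
  exact congrArg (fun L : E →L[ℝ] E ↦ L (Ad E t Z)) e2

theorem contMDiff_one_mulInvariantVectorField (Z : GroupLieAlgebra 𝓘(ℝ, E) K) :
    ContMDiff 𝓘(ℝ, E) 𝓘(ℝ, E).tangent 1
      (fun g : K ↦ (⟨g, mulInvariantVectorField Z g⟩ : TangentBundle 𝓘(ℝ, E) K)) := by
  have : LieGroup 𝓘(ℝ, E) (minSmoothness ℝ 3) K :=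
    .of_le (n := ∞) (by simpa using ENat.LEInfty.out)
  exact (contMDiff_mulInvariantVectorField Z).of_le (by simp)

theorem IsMIntegralCurveOn.mul_left {Z : GroupLieAlgebra 𝓘(ℝ, E) K} {γ : ℝ → K} {s : Set ℝ}
    (hγ : IsMIntegralCurveOn γ (mulInvariantVectorField Z) s) (k : K) :
    IsMIntegralCurveOn (fun r ↦ k * γ r) (mulInvariantVectorField Z) s := by
  intro r hr
  have h1 : MDifferentiableAt 𝓘(ℝ, E) 𝓘(ℝ, E) (fun x : K ↦ k * x) (γ r) :=
    (contMDiff_mul_left (n := ∞)).mdifferentiable (by simp) _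
  have h := h1.hasMFDerivAt.comp_hasMFDerivWithinAt r (hγ r hr)
  have e : (mfderiv 𝓘(ℝ, E) 𝓘(ℝ, E) (fun x : K ↦ k * x) (γ r) : E →L[ℝ] E).comp
      ((1 : ℝ →L[ℝ] ℝ).smulRight (mulInvariantVectorField Z (γ r) : E)) =
      (1 : ℝ →L[ℝ] ℝ).smulRight (mulInvariantVectorField Z (k * γ r) : E) := by
    ext
    simpa using mfderiv_mul_left_mulInvariantVectorField k (γ r) Z
  exact e ▸ h

theorem IsMIntegralCurve.mul_left {Z : GroupLieAlgebra 𝓘(ℝ, E) K} {γ : ℝ → K}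
    (hγ : IsMIntegralCurve γ (mulInvariantVectorField Z)) (k : K) :
    IsMIntegralCurve (fun r ↦ k * γ r) (mulInvariantVectorField Z) := by
  rw [isMIntegralCurve_iff_isMIntegralCurveOn] at hγ ⊢
  exact hγ.mul_left k

theorem IsMIntegralCurve.conj {Z : GroupLieAlgebra 𝓘(ℝ, E) K} {γ : ℝ → K}
    (hγ : IsMIntegralCurve γ (mulInvariantVectorField Z)) {t : K} (ht : Ad E t Z = Z) :
    IsMIntegralCurve (fun r ↦ t * γ r * t⁻¹) (mulInvariantVectorField Z) := by
  intro r
  have h1 : MDifferentiableAt 𝓘(ℝ, E) 𝓘(ℝ, E) (fun x : K ↦ t * x * t⁻¹) (γ r) :=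
    (contMDiff_conj t).mdifferentiable (by simp) _
  have h := h1.hasMFDerivAt.comp r (hγ r)
  have e : (mfderiv 𝓘(ℝ, E) 𝓘(ℝ, E) (fun x : K ↦ t * x * t⁻¹) (γ r) : E →L[ℝ] E).comp
      ((1 : ℝ →L[ℝ] ℝ).smulRight (mulInvariantVectorField Z (γ r) : E)) =
      (1 : ℝ →L[ℝ] ℝ).smulRight (mulInvariantVectorField Z (t * γ r * t⁻¹) : E) := by
    ext
    have := mfderiv_conj_mulInvariantVectorField t (γ r) Z
    rw [ht] at this
    simpa using this
  exact e ▸ h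

/-- Left-invariant vector fields are complete: left translates of an integral curve through `1` give
integral curves through all points, with a uniform time of existence. -/
theorem exists_isMIntegralCurve_mulInvariantVectorField [CompleteSpace E] [T2Space K]
    (Z : GroupLieAlgebra 𝓘(ℝ, E) K) :
    ∃ γ : ℝ → K, γ 0 = 1 ∧ IsMIntegralCurve γ (mulInvariantVectorField Z) := by
  have : IsManifold 𝓘(ℝ, E) 1 K := .of_le (n := ∞) (by simp)
  have hZ := contMDiff_one_mulInvariantVectorField Z
  obtain ⟨γ, hγ0, hγ⟩ := exists_isMIntegralCurveAt_of_contMDiffAt_boundaryless 0 (hZ 1)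
  obtain ⟨ε, hε, hγ⟩ := isMIntegralCurveAt_iff'.1 hγ
  rw [Real.ball_eq_Ioo, zero_sub, zero_add] at hγ
  exact exists_isMIntegralCurve_of_isMIntegralCurveOn hZ hε
    (fun x ↦ ⟨fun r ↦ x * γ r, by simp [hγ0], hγ.mul_left x⟩) 1

/-- The integral curve through `1` of a left-invariant vector field is a one-parameter subgroup. -/
theorem IsMIntegralCurve.map_add_of_mulInvariantVectorField [T2Space K]
    {Z : GroupLieAlgebra 𝓘(ℝ, E) K} {γ : ℝ → K} (hγ0 : γ 0 = 1)
    (hγ : IsMIntegralCurve γ (mulInvariantVectorField Z)) (s r : ℝ) :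
    γ (s + r) = γ s * γ r := by
  have : IsManifold 𝓘(ℝ, E) 1 K := .of_le (n := ∞) (by simp)
  have h := isMIntegralCurve_Ioo_eq_of_contMDiff_boundaryless (t₀ := 0)
    (contMDiff_one_mulInvariantVectorField Z) (hγ.comp_add s) (hγ.mul_left (γ s))
    (by simp [hγ0])
  have := congrFun h r
  simpa [add_comm] using this

/-- If `Ad t` fixes `Z`, then `t` commutes with the one-parameter subgroup generated by `Z`. -/
theorem IsMIntegralCurve.commute_of_Ad_eq [T2Space K]
    {Z : GroupLieAlgebra 𝓘(ℝ, E) K} {γ : ℝ → K} (hγ0 : γ 0 = 1)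
    (hγ : IsMIntegralCurve γ (mulInvariantVectorField Z)) {t : K} (ht : Ad E t Z = Z) (r : ℝ) :
    Commute t (γ r) := by
  have : IsManifold 𝓘(ℝ, E) 1 K := .of_le (n := ∞) (by simp)
  have h := isMIntegralCurve_Ioo_eq_of_contMDiff_boundaryless (t₀ := 0)
    (contMDiff_one_mulInvariantVectorField Z) (hγ.conj ht) hγ (by simp [hγ0])
  exact mul_inv_eq_iff_eq_mul.1 (congrFun h r)

theorem Ad_mul_apply (s t : K) (Z : E) : Ad E (s * t) Z = Ad E s (Ad E t Z) := by
  have h1 : MDifferentiableAt 𝓘(ℝ, E) 𝓘(ℝ, E) (fun x : K ↦ s * x * s⁻¹) (t * 1 * t⁻¹) :=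
    (contMDiff_conj s).mdifferentiable (by simp) _
  have h2 : MDifferentiableAt 𝓘(ℝ, E) 𝓘(ℝ, E) (fun x : K ↦ t * x * t⁻¹) 1 :=
    (contMDiff_conj t).mdifferentiable (by simp) _
  have h := congrArg (fun L : E →L[ℝ] E ↦ L Z) (mfderiv_comp (1 : K) h1 h2)
  have e : (fun x : K ↦ s * x * s⁻¹) ∘ (fun x : K ↦ t * x * t⁻¹) =
      fun x : K ↦ s * t * x * (s * t)⁻¹ := by
    funext x; simp [mul_assoc]
  have e1 : (mfderiv 𝓘(ℝ, E) 𝓘(ℝ, E) (fun x : K ↦ s * x * s⁻¹) (t * 1 * t⁻¹) : E →L[ℝ] E) =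
      mfderiv 𝓘(ℝ, E) 𝓘(ℝ, E) (fun x : K ↦ s * x * s⁻¹) 1 := by rw [mul_one, mul_inv_cancel]
  have e2 := congrArg (fun f : K → K ↦ (mfderiv 𝓘(ℝ, E) 𝓘(ℝ, E) f 1 : E →L[ℝ] E) Z) e
  exact e2.symm.trans (h.trans (congrArg (fun L : E →L[ℝ] E ↦ L (Ad E t Z)) e1))

theorem continuous_Ad : Continuous (fun t : K ↦ Ad E t) := by
  set φ := extChartAt 𝓘(ℝ, E) (1 : K) with hφ
  let F : K → E → E := fun t y ↦ φ (t * φ.symm y * t⁻¹)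
  have hAd : ∀ t : K, Ad E t = fderiv ℝ (F t) (φ 1) := by
    intro t
    have h := ((contMDiff_conj (E := E) t).mdifferentiable (by simp) 1).mfderiv
    have e : writtenInExtChartAt 𝓘(ℝ, E) 𝓘(ℝ, E) (1 : K) (fun g : K ↦ t * g * t⁻¹) = F t := by
      funext y
      simp [writtenInExtChartAt, F, hφ]
    rw [e, ModelWithCorners.range_eq_univ, fderivWithin_univ] at h
    exact h
  simp_rw [hAd]
  refine continuous_iff_continuousAt.2 fun t ↦ ?_
  have hs : φ.symm (φ 1) = 1 := φ.left_inv (mem_extChartAt_source 1)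
  have h1 : ContMDiffAt (𝓘(ℝ, E).prod 𝓘(ℝ, E)) 𝓘(ℝ, E) ∞
      (fun p : K × E ↦ φ.symm p.2) (t, φ 1) :=
    ContMDiffAt.comp (t, φ 1) ((contMDiffOn_extChartAt_symm (1 : K)).contMDiffAt
      ((isOpen_extChartAt_target _).mem_nhds (mem_extChartAt_target _))) contMDiffAt_snd
  have h2 : ContMDiffAt (𝓘(ℝ, E).prod 𝓘(ℝ, E)) 𝓘(ℝ, E) ∞
      (fun p : K × E ↦ p.1 * φ.symm p.2 * p.1⁻¹) (t, φ 1) :=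
    (contMDiffAt_fst.mul h1).mul contMDiffAt_fst.inv
  have h3 : ContMDiffAt (𝓘(ℝ, E).prod 𝓘(ℝ, E)) 𝓘(ℝ, E) ∞ (Function.uncurry F) (t, φ 1) := by
    refine ContMDiffAt.comp (t, φ 1) (g := φ) ?_ h2
    simp only [hs, mul_one, mul_inv_cancel]
    exact contMDiffAt_extChartAt
  exact ContinuousAt.comp (f := fun t : K ↦ (t, φ 1)) h3.fderiv_right_of_uncurry.continuousAt
    (by fun_prop)

/-- A functional invariant under `Ad t` for all `t` in a compact subgroup takes all its values on
fixed vectors: replace `Z` by its average over the subgroup. -/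
theorem exists_Ad_eq_and_eq [FiniteDimensional ℝ E] {T : Subgroup K} (hT : IsCompact (T : Set K))
    (l : E →L[ℝ] ℝ) (hl : ∀ t ∈ T, ∀ Z, l (Ad E t Z) = l Z) (Z : E) :
    ∃ Z' : E, (∀ t ∈ T, Ad E t Z' = Z') ∧ l Z' = l Z := by
  have : IsTopologicalGroup K := topologicalGroup_of_lieGroup 𝓘(ℝ, E) ∞
  have : CompactSpace T := isCompact_iff_compactSpace.1 hT
  let _ : MeasurableSpace T := borel T
  have : BorelSpace T := ⟨rfl⟩
  let ν : Measure T := Measure.haarMeasure ⊤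
  have : IsProbabilityMeasure ν := ⟨Measure.haarMeasure_self⟩
  have hc : Continuous fun t : T ↦ Ad E (t : K) Z :=
    (continuous_Ad.comp continuous_subtype_val).clm_apply continuous_const
  have hi : Integrable (fun t : T ↦ Ad E (t : K) Z) ν :=
    hc.integrable_of_hasCompactSupport (HasCompactSupport.of_compactSpace _)
  refine ⟨∫ t : T, Ad E (t : K) Z ∂ν, fun s hs ↦ ?_, ?_⟩
  · rw [← (Ad E s).integral_comp_comm hi]
    have := integral_mul_left_eq_self (μ := ν) (fun t : T ↦ Ad E (t : K) Z) ⟨s, hs⟩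
    simpa [Ad_mul_apply] using this
  · rw [← l.integral_comp_comm hi]
    simp [hl]

end LieGroup

/-! ### Maximal tori -/

section Torus

variable {K : Type*} [Group K] [TopologicalSpace K]

/-- A one-parameter subgroup commuting with a maximal torus lies in it: the closure of the group
generated by both is again a torus. -/
theorem IsMaximalTorus.mem_of_forall_commute [IsTopologicalGroup K] [CompactSpace K] [T2Space K]
    {T : Subgroup K} (hT : IsMaximalTorus T) {γ : ℝ → K} (hγ : Continuous γ)
    (hadd : ∀ s r, γ (s + r) = γ s * γ r) (hcomm : ∀ t ∈ T, ∀ r, Commute t (γ r)) (r : ℝ) :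
    γ r ∈ T := by
  have h0 : γ 0 = 1 := by simpa using hadd 0 0
  have hγγ : ∀ s r, Commute (γ s) (γ r) := fun s r ↦ by
    rw [Commute, SemiconjBy, ← hadd, ← hadd, add_comm]
  -- The subgroup `T · γ(ℝ)`, a continuous image of the connected space `T × ℝ`.
  let A : Subgroup K :=
    { carrier := range fun p : T × ℝ ↦ (p.1 : K) * γ p.2
      one_mem' := ⟨(1, 0), by simp [h0]⟩
      mul_mem' := by
        rintro _ _ ⟨⟨t, s⟩, rfl⟩ ⟨⟨t', s'⟩, rfl⟩
        refine ⟨(t * t', s + s'), ?_⟩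
        simp only [Subgroup.coe_mul, hadd]
        exact ((hcomm t' t'.2 s).symm.mul_mul_mul_comm _ _).symm
      inv_mem' := by
        rintro _ ⟨⟨t, s⟩, rfl⟩
        refine ⟨(t⁻¹, -s), ?_⟩
        have hs : γ (-s) = (γ s)⁻¹ := eq_inv_of_mul_eq_one_left (by rw [← hadd]; simp [h0])
        simp only [Subgroup.coe_inv, hs, mul_inv_rev]
        exact ((hcomm t t.2 s).inv_inv).eq }
  have hAcomm : ∀ x y : A, x * y = y * x := by
    rintro ⟨_, ⟨⟨t, s⟩, rfl⟩⟩ ⟨_, ⟨⟨t', s'⟩, rfl⟩⟩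
    refine Subtype.ext ?_
    have htt : Commute (t : K) t' := hT.prop.mul_comm t t.2 t' t'.2
    exact (htt.mul_right (hcomm t t.2 s')).mul_left ((hcomm t' t'.2 s).symm.mul_right (hγγ s s'))
  have hTA : T ≤ A := fun t ht ↦ ⟨(⟨t, ht⟩, 0), by simp [h0]⟩
  have hAconn : IsConnected (A : Set K) := by
    have : ConnectedSpace T := isConnected_iff_connectedSpace.1 hT.prop.isConnected
    exact isConnected_range (by fun_prop)
  have htorus : IsTorus A.topologicalClosure :=
    { isCompact := A.isClosed_topologicalClosure.isCompact
      isConnected := hAconn.closure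
      mul_comm := fun a ha b hb ↦ congrArg Subtype.val
        ((A.commGroupTopologicalClosure hAcomm).mul_comm ⟨a, ha⟩ ⟨b, hb⟩) }
  exact hT.le_of_ge htorus (hTA.trans A.le_topologicalClosure)
    (A.le_topologicalClosure ⟨(1, r), by simp⟩)

end Torus

/-! ### Local sections of submersions -/

section Submersion

open Manifold

/-- A submersion has a smooth local section through every point: in charts where it is the
projection `(u, v) ↦ u`, keep the second coordinate constant. -/
theorem Manifold.IsSubmersion.exists_contMDiffAt_section
    {E : Type*} [NormedAddCommGroup E] [NormedSpace ℝ E]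
    {X : Type*} [TopologicalSpace X] [ChartedSpace E X] [IsManifold 𝓘(ℝ, E) ∞ X]
    {E' : Type*} [NormedAddCommGroup E'] [NormedSpace ℝ E']
    {Y : Type*} [TopologicalSpace Y] [ChartedSpace E' Y] [IsManifold 𝓘(ℝ, E') ∞ Y]
    {f : X → Y} (hf : IsSubmersion 𝓘(ℝ, E) 𝓘(ℝ, E') ∞ f) (x : X) :
    ∃ σ : Y → X, σ (f x) = x ∧ ContMDiffAt 𝓘(ℝ, E') 𝓘(ℝ, E) ∞ σ (f x) ∧
      f ∘ σ =ᶠ[𝓝 (f x)] id := by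
  obtain ⟨F, _, _, hF⟩ := hf
  have h := hF x
  set D := h.domChart.extend 𝓘(ℝ, E) with hD
  set C := h.codChart.extend 𝓘(ℝ, E') with hC
  have hw : ∀ u ∈ D.target, C (f (D.symm u)) = (h.equiv u).1 := fun u hu ↦ h.writtenInCharts hu
  have hxD : x ∈ D.source := by simpa [hD] using h.mem_domChart_source
  have hxC : f x ∈ C.source := by simpa [hC] using h.mem_codChart_source
  have hDo : IsOpen D.target := by
    simpa [hD] using h.domChart.isOpen_extend_target (I := 𝓘(ℝ, E))
  have hCo : IsOpen C.source := by simpa [hC] using h.codChart.open_source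
  have ha : C (f x) = (h.equiv (D x)).1 := by
    rw [← hw _ (D.map_source hxD), D.left_inv hxD]
  let j : Y → E := fun m ↦ h.equiv.symm (C m, (h.equiv (D x)).2)
  have hjx : j (f x) = D x := by simp [j, ha]
  have hC' : ContMDiffAt 𝓘(ℝ, E') 𝓘(ℝ, E') ∞ C (f x) :=
    contMDiffAt_of_mem_maximalAtlas h.codChart_mem_maximalAtlas h.mem_codChart_source
  have hj : ContMDiffAt 𝓘(ℝ, E') 𝓘(ℝ, E) ∞ j (f x) :=
    ContMDiffAt.comp (f x) (g := fun a : E' ↦ h.equiv.symm (a, (h.equiv (D x)).2)) (f := C)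
      (ContDiff.contMDiff (by fun_prop)).contMDiffAt hC'
  refine ⟨fun m ↦ D.symm (j m), ?_, ?_, ?_⟩
  · simp only [hjx]
    exact D.left_inv hxD
  · refine ContMDiffAt.comp (f x) (g := D.symm) ?_ hj
    rw [hjx]
    exact contMDiffAt_symm_of_mem_maximalAtlas h.domChart_mem_maximalAtlas
      (h.domChart.map_source h.mem_domChart_source)
  · filter_upwards [hCo.mem_nhds hxC, hj.continuousAt.preimage_mem_nhds
      (hDo.mem_nhds (by rw [hjx]; exact D.map_source hxD))] with m hm hm'
    have h1 : C (f (D.symm (j m))) = C m := by rw [hw _ hm']; simp [j]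
    have h2 : f (D.symm (j m)) ∈ C.source := by
      have h3 : D.symm (j m) ∈ h.domChart.source := by simpa [hD] using D.map_target hm'
      simpa [hC] using h.mapsto_domChart_source_codChart_source h3
    exact C.injOn h2 hm h1

end Submersion

/-! ### One-forms on a homogeneous space -/

section Homogeneous

variable {E : Type*} [NormedAddCommGroup E] [NormedSpace ℝ E]
  {K : Type*} [Group K] [TopologicalSpace K] [ChartedSpace E K]
  {H : Subgroup K}
  {E' : Type*} [NormedAddCommGroup E'] [NormedSpace ℝ E']
  [ChartedSpace E' (K ⧸ H)]

namespace DiffForm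

/-- The covector on the Lie algebra `T₁K` obtained from a `1`-form `η` on `K ⧸ H` by pulling back
under `g ↦ k g H` at `g = 1`. Equivalently, the value at `k` of the pullback of `η` to `K`, in the
trivialization of the tangent bundle of `K` by left translations. -/
def liftAt (η : DiffForm E' (K ⧸ H) 1) (k : K) : E [⋀^Fin 1]→L[ℝ] ℝ :=
  η.pullback (E := E) (fun g : K ↦ (QuotientGroup.mk (k * g) : K ⧸ H)) 1

/-- Allows the map in the definition of `liftAt` to be rewritten along an equality of functions. -/
theorem liftAt_congr (η : DiffForm E' (K ⧸ H) 1) {k : K} {f : K → K ⧸ H}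
    (h : (fun g : K ↦ (QuotientGroup.mk (k * g) : K ⧸ H)) = f) :
    (η.liftAt (E := E) k : E [⋀^Fin 1]→L[ℝ] ℝ) = η.pullback (E := E) f 1 := by
  subst h; rfl

end DiffForm

variable [LieGroup 𝓘(ℝ, E) ∞ K]

variable [IsManifold 𝓘(ℝ, E') ∞ (K ⧸ H)] in
/-- The action of `K` on `K ⧸ H` is smooth: near `x = g H` it is `(k, x) ↦ k σ(x) H` for a local
section `σ` of the projection. -/
theorem contMDiffSMul_quotient
    (hπ : Manifold.IsSubmersion 𝓘(ℝ, E) 𝓘(ℝ, E') ∞ (QuotientGroup.mk : K → K ⧸ H)) :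
    ContMDiffSMul 𝓘(ℝ, E) 𝓘(ℝ, E') ∞ K (K ⧸ H) := by
  refine ⟨?_⟩
  rintro ⟨k, m⟩
  obtain ⟨g, rfl⟩ := QuotientGroup.mk_surjective m
  obtain ⟨σ, -, hσ, hσπ⟩ := hπ.exists_contMDiffAt_section g
  have h : ContMDiffAt (𝓘(ℝ, E).prod 𝓘(ℝ, E')) 𝓘(ℝ, E') ∞
      (fun p : K × K ⧸ H ↦ (QuotientGroup.mk (p.1 * σ p.2) : K ⧸ H)) (k, (g : K ⧸ H)) := by
    refine ContMDiffAt.comp _ (g := (QuotientGroup.mk : K → K ⧸ H)) hπ.contMDiff.contMDiffAt ?_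
    exact contMDiffAt_fst.mul (ContMDiffAt.comp _ hσ contMDiffAt_snd)
  refine h.congr_of_eventuallyEq ?_
  filter_upwards [continuousAt_snd.eventually hσπ] with p hp
  have hp' : (QuotientGroup.mk (σ p.2) : K ⧸ H) = p.2 := hp
  conv_lhs => rw [← hp']
  rfl

namespace DiffForm

theorem contMDiff_mk_mul
    (hπ : Manifold.IsSubmersion 𝓘(ℝ, E) 𝓘(ℝ, E') ∞ (QuotientGroup.mk : K → K ⧸ H)) (k : K) :
    ContMDiff 𝓘(ℝ, E) 𝓘(ℝ, E') ∞ (fun g : K ↦ (QuotientGroup.mk (k * g) : K ⧸ H)) :=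
  hπ.contMDiff.comp contMDiff_mul_left

/-- Right translation by `t ∈ H` acts on the lift of `η` through `Ad t`, because
`k t g H = k (t g t⁻¹) H`. -/
theorem liftAt_mul_apply
    (hπ : Manifold.IsSubmersion 𝓘(ℝ, E) 𝓘(ℝ, E') ∞ (QuotientGroup.mk : K → K ⧸ H))
    (η : DiffForm E' (K ⧸ H) 1) (k : K) {t : K} (ht : t ∈ H) (Z : E) :
    η.liftAt (k * t) (fun _ ↦ Z) = η.liftAt (E := E) k (fun _ ↦ Ad E t Z) := by
  have e : (fun g : K ↦ (QuotientGroup.mk (k * t * g) : K ⧸ H)) =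
      (fun g : K ↦ (QuotientGroup.mk (k * g) : K ⧸ H)) ∘ fun g ↦ t * g * t⁻¹ := by
    funext g
    rw [Function.comp_apply, QuotientGroup.eq]
    simpa [mul_assoc] using H.inv_mem ht
  rw [liftAt_congr η e, pullback_comp_apply η ((contMDiff_mk_mul hπ k).mdifferentiable (by simp) _)
    ((contMDiff_conj t).mdifferentiable (by simp) _)]
  have h : ∀ g : K, g = 1 → ∀ w : E, (η.pullback (E := E) (fun g : K ↦
      (QuotientGroup.mk (k * g) : K ⧸ H)) g : E [⋀^Fin 1]→L[ℝ] ℝ) (fun _ ↦ w) =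
      η.liftAt (E := E) k (fun _ ↦ w) := by
    rintro _ rfl w; rfl
  exact h _ (by simp) _

/-- The lift of a form on `K ⧸ H` vanishes on vectors tangent at `1` to a curve in `H`. -/
theorem liftAt_apply_eq_zero
    (hπ : Manifold.IsSubmersion 𝓘(ℝ, E) 𝓘(ℝ, E') ∞ (QuotientGroup.mk : K → K ⧸ H))
    (η : DiffForm E' (K ⧸ H) 1) {γ : ℝ → K} {Z : E} (hγ0 : γ 0 = 1)
    (hγ : HasMFDerivAt 𝓘(ℝ, ℝ) 𝓘(ℝ, E) γ 0 ((1 : ℝ →L[ℝ] ℝ).smulRight Z))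
    (hγH : ∀ r, γ r ∈ H) (k : K) : η.liftAt (E := E) k (fun _ ↦ Z) = 0 := by
  let f : K → K ⧸ H := fun g ↦ QuotientGroup.mk (k * g)
  have hf : HasMFDerivAt 𝓘(ℝ, E) 𝓘(ℝ, E') f (γ 0) (mfderiv 𝓘(ℝ, E) 𝓘(ℝ, E') f (γ 0)) :=
    ((contMDiff_mk_mul hπ k).mdifferentiable (by simp) _).hasMFDerivAt
  have hfγ : f ∘ γ = fun _ ↦ (k : K ⧸ H) := by
    funext r
    rw [Function.comp_apply, QuotientGroup.eq]
    simpa using hγH r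
  have h := hf.comp (0 : ℝ) hγ
  rw [hfγ] at h
  let D : E →L[ℝ] E' := mfderiv 𝓘(ℝ, E) 𝓘(ℝ, E') f (γ 0)
  have h1 : D.comp ((1 : ℝ →L[ℝ] ℝ).smulRight Z) = 0 :=
    hasMFDerivAt_unique h (hasMFDerivAt_const _ _)
  have h2 : D Z = 0 := by simpa using DFunLike.congr_fun h1 1
  have e : D = (mfderiv 𝓘(ℝ, E) 𝓘(ℝ, E') f 1 : E →L[ℝ] E') := by simp only [D]; rw [hγ0]
  have h3 := (congrArg (fun L : E →L[ℝ] E' ↦ L Z) e).symm.trans h2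
  exact (η (f 1) : E' [⋀^Fin 1]→L[ℝ] ℝ).map_coord_zero (0 : Fin 1) h3

variable [IsManifold 𝓘(ℝ, E') ∞ (K ⧸ H)]

/-- Every tangent vector `v` at `g H` is the image of some `Z ∈ T₁K` under the derivative of
`g' ↦ g g' H`, and evaluating `k^* η` on `v` amounts to evaluating the lift of `η` at `k g`
on `Z`. -/
theorem exists_pullback_smul_apply_eq_liftAt
    (hπ : Manifold.IsSubmersion 𝓘(ℝ, E) 𝓘(ℝ, E') ∞ (QuotientGroup.mk : K → K ⧸ H))
    (η : DiffForm E' (K ⧸ H) 1) (g : K) (v : E') :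
    ∃ Z : E, ∀ k : K, (η.pullback (E := E') (fun x : K ⧸ H ↦ k • x) (g : K ⧸ H) :
      E' [⋀^Fin 1]→L[ℝ] ℝ) (fun _ ↦ v) = η.liftAt (k * g) (fun _ ↦ Z) := by
  have := contMDiffSMul_quotient hπ
  obtain ⟨σ, hσg, hσ, hσπ⟩ := hπ.exists_contMDiffAt_section g
  let x : K ⧸ H := g
  let h : K ⧸ H → K := fun y ↦ g⁻¹ * σ y
  have hh : MDifferentiableAt 𝓘(ℝ, E') 𝓘(ℝ, E) h x :=
    (contMDiffAt_const.mul hσ).mdifferentiableAt (by simp)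
  have hx : h x = 1 := by simp [h, x, hσg]
  refine ⟨mfderiv 𝓘(ℝ, E') 𝓘(ℝ, E) h x v, fun k ↦ ?_⟩
  have e : (fun x : K ⧸ H ↦ k • x) =ᶠ[𝓝 x]
      (fun g' : K ↦ (QuotientGroup.mk (k * g * g') : K ⧸ H)) ∘ h := by
    filter_upwards [hσπ] with y hy
    have hy' : (QuotientGroup.mk (σ y) : K ⧸ H) = y := hy
    conv_lhs => rw [← hy']
    simp only [Function.comp_apply, h, mul_assoc, mul_inv_cancel_left]
    rfl
  have e1 := pullback_congr (E := E') η e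
  rw [pullback_comp_apply η ((contMDiff_mk_mul hπ _).mdifferentiable (by simp) _) hh] at e1
  have h1 : ∀ g' : K, g' = 1 → ∀ w : E, (η.pullback (E := E) (fun g' : K ↦
      (QuotientGroup.mk (k * g * g') : K ⧸ H)) g' : E [⋀^Fin 1]→L[ℝ] ℝ) (fun _ ↦ w) =
      η.liftAt (E := E) (k * g) (fun _ ↦ w) := by
    rintro _ rfl w; rfl
  exact (congrArg (fun a : E' [⋀^Fin 1]→L[ℝ] ℝ ↦ a fun _ ↦ v) e1).trans (h1 _ hx _)

theorem continuous_liftAt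
    (hπ : Manifold.IsSubmersion 𝓘(ℝ, E) 𝓘(ℝ, E') ∞ (QuotientGroup.mk : K → K ⧸ H))
    {η : DiffForm E' (K ⧸ H) 1} (hη : η.IsSmooth) :
    Continuous fun k : K ↦ η.liftAt (E := E) k := by
  have := contMDiffSMul_quotient hπ
  have e : ∀ k : K, η.liftAt (E := E) k =
      (η.pullback (E := E') (fun x : K ⧸ H ↦ k • x) ((1 : K) : K ⧸ H) :
        E' [⋀^Fin 1]→L[ℝ] ℝ).compContinuousLinearMap
        (mfderiv 𝓘(ℝ, E) 𝓘(ℝ, E') (QuotientGroup.mk : K → K ⧸ H) 1 : E →L[ℝ] E') := fun k ↦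
    (liftAt_congr η (f := (fun x : K ⧸ H ↦ k • x) ∘ QuotientGroup.mk) rfl).trans
      (pullback_comp_apply η
      ((ContMDiffSMul.contMDiff_const_smul (I := 𝓘(ℝ, E)) (n := ∞) k).mdifferentiable (by simp) _)
      (hπ.contMDiff.mdifferentiable (by simp) _))
  simp_rw [e]
  exact (ContinuousAlternatingMap.compContinuousLinearMapCLM (𝕜 := ℝ) (ι := Fin 1) (F := ℝ)
    (mfderiv 𝓘(ℝ, E) 𝓘(ℝ, E') (QuotientGroup.mk : K → K ⧸ H) 1 : E →L[ℝ] E')).continuous.comp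
    (continuous_pullback_smul E hη _)

/-- The average over `K` of the lift of a `1`-form on `K ⧸ H` vanishes. It is an `Ad T`-invariant
functional, so it suffices to evaluate it on a vector `Z'` fixed by `Ad T`. Such a vector generates
a one-parameter subgroup commuting with `T`, which lies in `T ≤ H` by maximality; hence `Z'` is
annihilated by the lift at every point. -/
theorem integral_liftAt_apply_eq_zero
    (hπ : Manifold.IsSubmersion 𝓘(ℝ, E) 𝓘(ℝ, E') ∞ (QuotientGroup.mk : K → K ⧸ H))
    [FiniteDimensional ℝ E] [CompactSpace K] [T2Space K]
    [MeasurableSpace K] [BorelSpace K] (μ : Measure K) [IsFiniteMeasure μ]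
    [μ.IsMulRightInvariant] {T : Subgroup K} (hT : IsMaximalTorus T) (hTH : T ≤ H)
    {η : DiffForm E' (K ⧸ H) 1} (hη : η.IsSmooth) (Z : E) :
    ∫ k : K, η.liftAt (E := E) k (fun _ ↦ Z) ∂μ = 0 := by
  have : IsTopologicalGroup K := topologicalGroup_of_lieGroup 𝓘(ℝ, E) ∞
  have : SecondCountableTopology K := ChartedSpace.secondCountable_of_sigmaCompact E K
  let L := ContinuousAlternatingMap.ofSubsingletonLIE (𝕜 := ℝ) (E := E) (F := ℝ) (0 : Fin 1)
  let l : E →L[ℝ] ℝ := L.symm (∫ k : K, η.liftAt (E := E) k ∂μ)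
  have hi : Integrable (fun k : K ↦ η.liftAt (E := E) k) μ :=
    (continuous_liftAt hπ hη).integrable_of_hasCompactSupport (HasCompactSupport.of_compactSpace _)
  have hl : ∀ Z, l Z = ∫ k : K, η.liftAt (E := E) k (fun _ ↦ Z) ∂μ := fun Z ↦
    ((ContinuousAlternatingMap.apply ℝ E ℝ fun _ : Fin 1 ↦ Z).integral_comp_comm hi).symm
  obtain ⟨Z', hZ', hlZ'⟩ := exists_Ad_eq_and_eq hT.prop.isCompact l (fun t ht Z ↦ by
    simp_rw [hl, ← liftAt_mul_apply hπ η _ (hTH ht)]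
    exact integral_mul_right_eq_self (fun k ↦ η.liftAt (E := E) k fun _ ↦ Z) t) Z
  obtain ⟨γ, hγ0, hγ⟩ := exists_isMIntegralCurve_mulInvariantVectorField (K := K) Z'
  have hγT : ∀ r, γ r ∈ T := hT.mem_of_forall_commute
    (continuous_iff_continuousAt.2 fun r ↦ (hγ r).continuousAt)
    (hγ.map_add_of_mulInvariantVectorField hγ0)
    (fun t ht r ↦ hγ.commute_of_Ad_eq hγ0 (hZ' t ht) r)
  have hγ' : HasMFDerivAt 𝓘(ℝ, ℝ) 𝓘(ℝ, E) γ 0 ((1 : ℝ →L[ℝ] ℝ).smulRight Z') := by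
    have e : (mulInvariantVectorField (I := 𝓘(ℝ, E)) (G := K) Z' (γ 0) : E) = Z' := by
      rw [hγ0]
      have h1 : (fun x : K ↦ 1 * x) = id := funext one_mul
      have h2 : (mfderiv 𝓘(ℝ, E) 𝓘(ℝ, E) (fun x : K ↦ 1 * x) 1 : E →L[ℝ] E) =
          ContinuousLinearMap.id ℝ E := by rw [h1]; exact mfderiv_id
      exact congrArg (fun L : E →L[ℝ] E ↦ L Z') h2
    exact e ▸ hγ 0
  rw [← hl, ← hlZ', hl]
  simp [liftAt_apply_eq_zero hπ η hγ0 hγ' (fun r ↦ hTH (hγT r))]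

theorem d_eq_zero_of_isInvariant_of_isMaximalTorus_le [FiniteDimensional ℝ E]
    [FiniteDimensional ℝ E'] [CompactSpace K] [T2Space K]
    (hπ : Manifold.IsSubmersion 𝓘(ℝ, E) 𝓘(ℝ, E') ∞ (QuotientGroup.mk : K → K ⧸ H))
    {T : Subgroup K} (hT : IsMaximalTorus T) (hTH : T ≤ H)
    {η : DiffForm E' (K ⧸ H) 1} (hη : η.IsSmooth) (hinv : η.d.IsInvariant K) : η.d = 0 := by
  have : IsTopologicalGroup K := topologicalGroup_of_lieGroup 𝓘(ℝ, E) ∞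
  have : SecondCountableTopology K := ChartedSpace.secondCountable_of_sigmaCompact E K
  have := contMDiffSMul_quotient hπ
  let _ : MeasurableSpace K := borel K
  have : BorelSpace K := ⟨rfl⟩
  -- The inverse of a left Haar measure is right invariant, which is the invariance needed here.
  let μ : Measure K := (Measure.haarMeasure ⊤).inv
  have : IsFiniteMeasure μ := inferInstance
  have : NeZero μ := inferInstance
  refine d_eq_zero_of_integral_pullback_smul_eq_zero E μ hη (fun x v ↦ ?_) hinv
  obtain ⟨g, rfl⟩ := QuotientGroup.mk_surjective x
  obtain ⟨Z, hZ⟩ := exists_pullback_smul_apply_eq_liftAt hπ η g v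
  simp_rw [hZ]
  rw [integral_mul_right_eq_self (fun k ↦ η.liftAt (E := E) k fun _ ↦ Z) g]
  exact integral_liftAt_apply_eq_zero hπ μ hT hTH hη Z

end DiffForm

end Homogeneous

end InvariantForms

/-- `K` is a compact Lie group and `H` a compact subgroup containing a maximal torus of `K`.
The coset space `K ⧸ H` carries its quotient topology, the action of `K` by left translations and
its structure of a homogeneous manifold, i.e. the (unique) smooth structure for which the projection
`K → K ⧸ H` is a smooth submersion. -/
theorem lemma2p6
    {E : Type*} [NormedAddCommGroup E] [NormedSpace ℝ E] [FiniteDimensional ℝ E]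
    {K : Type*} [Group K] [TopologicalSpace K] [ChartedSpace E K] [LieGroup 𝓘(ℝ, E) ∞ K]
    [CompactSpace K] [T2Space K]
    (H : Subgroup K) (hH : IsCompact (H : Set K))
    (hT : ∃ T : Subgroup K, IsMaximalTorus T ∧ T ≤ H)
    {E' : Type*} [NormedAddCommGroup E'] [NormedSpace ℝ E'] [FiniteDimensional ℝ E']
    [ChartedSpace E' (K ⧸ H)] [IsManifold 𝓘(ℝ, E') ∞ (K ⧸ H)]
    (hπ : Manifold.IsSubmersion 𝓘(ℝ, E) 𝓘(ℝ, E') ∞ (QuotientGroup.mk : K → K ⧸ H))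
    (α : DiffForm E' (K ⧸ H) 2) (hs : α.IsSmooth)
    (hinv : α.IsInvariant K) (hclosed : α.IsClosed) :
    α.IsExact ↔ α = 0 := by
  constructor
  · rintro ⟨η, hη, rfl⟩
    obtain ⟨T, hT, hTH⟩ := hT
    exact DiffForm.d_eq_zero_of_isInvariant_of_isMaximalTorus_le hπ hT hTH hη hinv
  · rintro rfl
    exact DiffForm.isExact_zero
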